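/- Let $m,n\ge 0$ be integers, let $d_1,\dots,d_m\ge 1$ be integers, and let $\mathcal H=\bigotimes_{j=1}^m\mathcal H_j$ with $\mathcal H_j=\mathbb C^{d_j}$. A random pure state of $\mathcal H_j$ is a point of the projective space $\mathrm P(\mathcal H_j)$ distributed according to the uniform probability measure (the law of $U\psi_0$, where $\psi_0\in\mathrm P(\mathcal H_j)$ is fixed and $U\in\mathrm U(d_j)$ is Haar-random). A random product pure state of $\mathcal H$ is $\phi=\phi^1\otimes\dots\otimes\phi^m$ with independent random pure states $\phi^j$ of $\mathcal H_j$. Pure states $\psi_1,\dots,\psi_n$ of $\mathcal H$ are called unambiguously locally distinguishable if there is a POVM $\{E_k\}_{k=0,\dots,n}$ on $\mathcal H$ that can be implemented by (finitely many rounds of) local operations and classical communication between the $m$ parties, such that for all $k\in\{1,\dots,n\}$ and $j\in\{1,\dots,n\}$, $$\langle\psi_j|E_k|\psi_j\rangle=0\quad\text{if and only if}\quad j\ne k .$$ **Theorem.** For almost all $n$-tuples of product pure states $\phi_1,\dots,\phi_n$ of $\mathcal H$ (that is, with probability one when they are independent random product pure states), the states $\phi_1,\dots,\phi_n$ are unambiguously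 locally distinguishable if and only if $$n\;\le\;1+\sum_{j=1}^m(d_j-1).$$ Thus, if the inequality holds, almost all such $n$-tuples are unambiguously locally distinguishable, and if it fails, almost none are. -/

import Mathlib

open MeasureTheory
open scoped Matrix ComplexOrder

namespace LocalDiscrimination

/-! ## Pure states -/

/-- Pure states of the Hilbert space `ℂ^ι` (with its standard inner product): points of the
projective Hilbert space, i.e. nonzero vectors up to a nonzero complex factor. -/
abbrev PureState (ι : Type) : Type := Projectivization ℂ (ι → ℂ)

/-- The quotient topology on projective Hilbert space. -/
noncomputable instance instTopologicalSpacePureState (ι : Type) : TopologicalSpace (PureState ι) :=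
  TopologicalSpace.coinduced
    (fun v : {v : ι → ℂ // v ≠ 0} => (Projectivization.mk ℂ v.1 v.2 : PureState ι)) inferInstance

/-- The Borel σ-algebra of projective Hilbert space. -/
noncomputable instance instMeasurableSpacePureState (ι : Type) : MeasurableSpace (PureState ι) := borel _

instance instBorelSpacePureState (ι : Type) : BorelSpace (PureState ι) := ⟨rfl⟩

/-! ## The uniform probability measure on projective Hilbert space -/

/-- The unitary group `U(d)`. -/
abbrev UGroup (d : ℕ) : Type := Matrix.unitaryGroup (Fin d) ℂ

noncomputable instance instMeasurableSpaceUGroup (d : ℕ) : MeasurableSpace (UGroup d) := borel _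

instance instBorelSpaceUGroup (d : ℕ) : BorelSpace (UGroup d) := ⟨rfl⟩

instance instCompactSpaceUGroup (d : ℕ) : CompactSpace (UGroup d) := by
  refine isCompact_iff_compactSpace.mp ?_
  have hK : IsCompact (Set.univ.pi fun _ : Fin d => Set.univ.pi fun _ : Fin d =>
      Metric.closedBall (0 : ℂ) 1) :=
    isCompact_univ_pi fun _ => isCompact_univ_pi fun _ => isCompact_closedBall 0 1
  have hc : IsClosed ((Matrix.unitaryGroup (Fin d) ℂ : Set (Matrix (Fin d) (Fin d) ℂ))) :=
    isClosed_unitary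
  refine IsCompact.of_isClosed_subset (X := Matrix (Fin d) (Fin d) ℂ) hK hc ?_
  intro U hU i _ j _
  simpa using entry_norm_bound_of_unitary hU i j

/-- The unit Haar measure on `U(d)`. -/
noncomputable def haarUnitary (d : ℕ) : Measure (UGroup d) :=
  Measure.haarMeasure (⊤ : TopologicalSpace.PositiveCompacts (UGroup d))

theorem unitary_mulVec_ne_zero {d : ℕ} (U : UGroup d) {v : Fin d → ℂ} (hv : v ≠ 0) :
    (U : Matrix (Fin d) (Fin d) ℂ) *ᵥ v ≠ 0 := by
  intro h
  apply hv
  have h1 : (star (U : Matrix (Fin d) (Fin d) ℂ)) *ᵥ ((U : Matrix (Fin d) (Fin d) ℂ) *ᵥ v) = 0 := by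
    rw [h, Matrix.mulVec_zero]
  rwa [Matrix.mulVec_mulVec, Matrix.UnitaryGroup.star_mul_self, Matrix.one_mulVec] at h1

/-- The image `U ψ₀` of the fixed reference state `ψ₀ = [e₀]` under the unitary `U`. -/
noncomputable def rotatedState (d : ℕ) [NeZero d] (U : UGroup d) : PureState (Fin d) :=
  Projectivization.mk ℂ ((U : Matrix (Fin d) (Fin d) ℂ) *ᵥ Pi.single 0 1)
    (unitary_mulVec_ne_zero U (by simp))

theorem continuous_rotatedState (d : ℕ) [NeZero d] : Continuous (rotatedState d) := by
  have h1 : Continuous fun U : UGroup d =>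
      (⟨(U : Matrix (Fin d) (Fin d) ℂ) *ᵥ Pi.single 0 1,
        unitary_mulVec_ne_zero U (by simp)⟩ : {v : Fin d → ℂ // v ≠ 0}) :=
    Continuous.subtype_mk (continuous_subtype_val.matrix_mulVec continuous_const) _
  exact continuous_coinduced_rng.comp h1

/-- The uniform probability measure on the pure states of `ℂ^d`: the law of `U ψ₀` for a
Haar-random unitary `U`. -/
noncomputable def uniformPureState (d : ℕ) [NeZero d] : Measure (PureState (Fin d)) :=
  (haarUnitary d).map (rotatedState d)

instance instIsProbabilityMeasureHaarUnitary (d : ℕ) : IsProbabilityMeasure (haarUnitary d) := by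
  constructor
  have h := Measure.haarMeasure_self (K₀ := (⊤ : TopologicalSpace.PositiveCompacts (UGroup d)))
  simpa [haarUnitary] using h

instance instIsProbabilityMeasureUniformPureState (d : ℕ) [NeZero d] :
    IsProbabilityMeasure (uniformPureState d) :=
  Measure.isProbabilityMeasure_map (continuous_rotatedState d).measurable.aemeasurable

/-! ## Multipartite systems

The system of `m` parties with local dimensions `d i` has Hilbert space `⨂ i, ℂ^(d i)`, which is
`ℂ^(∏ i, d i)` with coordinates in the product basis, indexed by `Index d`. -/

/-- Index set of the product basis of `⨂ i, ℂ^(d i)`. -/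
abbrev Index {m : ℕ} (d : Fin m → ℕ) : Type := ∀ i, Fin (d i)

/-- The tensor product `⨂ i, v i` of local vectors, in the product basis. -/
def tensorVec {m : ℕ} {d : Fin m → ℕ} (v : ∀ i, Fin (d i) → ℂ) : Index d → ℂ :=
  fun x => ∏ i, v i (x i)

/-- The tensor product `⨂ i, A i` of local operators `A i : ℂ^(d i) → ℂ^(e i)`, in the product
bases. -/
def tensorOp {m : ℕ} {d e : Fin m → ℕ} (A : ∀ i, Matrix (Fin (e i)) (Fin (d i)) ℂ) :
    Matrix (Index e) (Index d) ℂ :=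
  Matrix.of fun x y => ∏ i, A i (x i) (y i)

theorem tensorVec_ne_zero {m : ℕ} {d : Fin m → ℕ} {v : ∀ i, Fin (d i) → ℂ} (hv : ∀ i, v i ≠ 0) :
    tensorVec v ≠ 0 := by
  choose x hx using fun i => Function.ne_iff.mp (hv i)
  exact Function.ne_iff.mpr ⟨x, Finset.prod_ne_zero_iff.mpr fun i _ => hx i⟩

/-- The product pure state `⨂ i, φ i`. -/
noncomputable def productState {m : ℕ} {d : Fin m → ℕ} (φ : ∀ i, PureState (Fin (d i))) :
    PureState (Index d) :=
  Projectivization.mk ℂ (tensorVec fun i => (φ i).rep)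
    (tensorVec_ne_zero fun i => (φ i).rep_nonzero)

/-! ## Measurements -/

/-- The expectation value `⟨ψ|E|ψ⟩` of the operator `E` in the pure state `ψ` (normalized, so that
it does not depend on the representing vector). -/
noncomputable def expectation {ι : Type} [Fintype ι] (E : Matrix ι ι ℂ) (ψ : PureState ι) : ℂ :=
  (star ψ.rep ⬝ᵥ (E *ᵥ ψ.rep)) / (star ψ.rep ⬝ᵥ ψ.rep)

/-- A positive operator valued measure with finite outcome set `K`. -/
def IsPOVM {ι K : Type} [Fintype ι] [DecidableEq ι] [Fintype K] (E : K → Matrix ι ι ℂ) : Prop :=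
  (∀ k, (E k).PosSemidef) ∧ ∑ k, E k = 1

/-- `IsLOCC d E` says that the measurement with operators `E k` (`k : K`) on `⨂ i, ℂ^(d i)` can be
implemented by local operations and classical communication, in finitely many rounds.

* `finish`: the parties announce the outcome `k₀` without touching the system.
* `round`: some party `j` performs a local measurement with Kraus operators
  `A a j : ℂ^(d j) → ℂ^(e a j)` and broadcasts the result `a`; given `a`, each other party `i`
  may apply a local isometry `A a i : ℂ^(d i) → ℂ^(e a i)` (the identity, a rotation, or adding
  an ancilla); then, depending on `a`, they go on with the LOCC measurement `F a` on the resulting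
  system. The outcome `k` then has operator `∑ a, (⨂ i, A a i)ᴴ (F a k) (⨂ i, A a i)`.

Local dimensions may change, so local ancillas and discarding of subsystems are covered; local
randomness is a measurement with Kraus operators proportional to the identity, and forgetting
classical information is ignoring `a`. -/
inductive IsLOCC {m : ℕ} {K : Type} [DecidableEq K] :
    (d : Fin m → ℕ) → (K → Matrix (Index d) (Index d) ℂ) → Prop
  | finish (d : Fin m → ℕ) (k₀ : K) : IsLOCC d (fun k => if k = k₀ then 1 else 0)
  | round (d : Fin m → ℕ) (j : Fin m) (r : ℕ) (e : Fin r → Fin m → ℕ)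
      (A : ∀ (a : Fin r) (i : Fin m), Matrix (Fin (e a i)) (Fin (d i)) ℂ)
      (F : ∀ a : Fin r, K → Matrix (Index (e a)) (Index (e a)) ℂ)
      (measurement : ∑ a, (A a j)ᴴ * A a j = 1)
      (isometry : ∀ a i, i ≠ j → (A a i)ᴴ * A a i = 1)
      (next : ∀ a, IsLOCC (e a) (F a)) :
      IsLOCC d (fun k => ∑ a, (tensorOp (A a))ᴴ * F a k * tensorOp (A a))

/-- The pure states `ψ 0, …, ψ (n - 1)` of `⨂ i, ℂ^(d i)` are unambiguously locally
distinguishable: there is an LOCC decomposable POVM with outcomes `0, …, n` such that outcome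
`k + 1` has nonzero probability in the state `ψ k` and zero probability in every other state `ψ j`.
Outcome `0` is inconclusive. -/
def UnambiguouslyLOCCDistinguishable {m n : ℕ} (d : Fin m → ℕ)
    (ψ : Fin n → PureState (Index d)) : Prop :=
  ∃ E : Fin (n + 1) → Matrix (Index d) (Index d) ℂ, IsPOVM E ∧ IsLOCC d E ∧
    ∀ j k : Fin n, expectation (E k.succ) (ψ j) = 0 ↔ j ≠ k

/-- The law of `n` independent random product pure states of `⨂ i, ℂ^(d i)`, given by their tensor
factors: the factors `φ k i` (`k : Fin n`, `i : Fin m`) are independent, each uniformly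
distributed. -/
noncomputable def randomProductStates {m : ℕ} (n : ℕ) (d : Fin m → ℕ) [∀ i, NeZero (d i)] :
    Measure (Fin n → ∀ i, PureState (Fin (d i))) :=
  Measure.pi fun _ => Measure.pi fun i => uniformPureState (d i)

end LocalDiscrimination

open MeasureTheory
open scoped Matrix ComplexOrder

namespace LocalDiscrimination

/-! ## Tensor products of local vectors and operators -/

/-! Almost surely the states are in general position: at party `i`, any at most `d i` of the local
factors are linearly independent (`ae_inGeneralPosition`). The equivalence then holds for every such
tuple.

Necessity: follow one LOCC branch in which the outcome for `φ k` occurs. The Kraus operators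
multiply up to a product operator `⨂ B i` that does not annihilate `φ k` but annihilates all the
other states (`IsLOCC.exists_tensorOp`). Each other state is therefore killed by some `B i`. Since
`B i ≠ 0`, general position lets it kill at most `d i - 1` of the factors, so `n - 1 ≤ ∑ (d i - 1)`.

Sufficiency: distribute the other `n - 1` states among the parties, at most `d i - 1` to party `i`.
Each party projects onto a line orthogonal to its assigned factors but not to that of `φ k`; joint
success identifies `φ k`. A uniform mixture over `k` treats all states at once.

General position reduces to a proper subspace being null for a random pure state, which follows from
invariance of Haar measure and a count on the moment curve. -/

theorem star_tensorVec_dotProduct {m : ℕ} {d : Fin m → ℕ} (v w : ∀ i, Fin (d i) → ℂ) :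
    star (tensorVec v) ⬝ᵥ tensorVec w = ∏ i, star (v i) ⬝ᵥ w i := by
  simp only [dotProduct, tensorVec, Pi.star_apply, star_prod, Fintype.prod_sum,
    Finset.prod_mul_distrib]

theorem tensorOp_mulVec_tensorVec {m : ℕ} {d e : Fin m → ℕ}
    (A : ∀ i, Matrix (Fin (e i)) (Fin (d i)) ℂ) (v : ∀ i, Fin (d i) → ℂ) :
    tensorOp A *ᵥ tensorVec v = tensorVec fun i => A i *ᵥ v i := by
  ext x
  simp only [Matrix.mulVec, dotProduct, tensorVec, tensorOp, Matrix.of_apply, Fintype.prod_sum,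
    Finset.prod_mul_distrib]

theorem tensorOp_mul {m : ℕ} {d e f : Fin m → ℕ} (B : ∀ i, Matrix (Fin (f i)) (Fin (e i)) ℂ)
    (A : ∀ i, Matrix (Fin (e i)) (Fin (d i)) ℂ) :
    tensorOp B * tensorOp A = tensorOp fun i => B i * A i := by
  ext x y
  simp only [Matrix.mul_apply, tensorOp, Matrix.of_apply, Fintype.prod_sum,
    Finset.prod_mul_distrib]

theorem conjTranspose_tensorOp {m : ℕ} {d e : Fin m → ℕ}
    (A : ∀ i, Matrix (Fin (e i)) (Fin (d i)) ℂ) :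
    (tensorOp A)ᴴ = tensorOp fun i => (A i)ᴴ := by
  ext x y
  simp [tensorOp, Matrix.conjTranspose_apply, star_prod]

theorem tensorOp_one {m : ℕ} (d : Fin m → ℕ) :
    tensorOp (fun i => (1 : Matrix (Fin (d i)) (Fin (d i)) ℂ)) = 1 := by
  ext x y
  by_cases h : x = y
  · subst h
    simp [tensorOp]
  · obtain ⟨i, hi⟩ := Function.ne_iff.mp h
    rw [Matrix.one_apply_ne h]
    exact Finset.prod_eq_zero (Finset.mem_univ i) (Matrix.one_apply_ne hi)

/-- A tensor product of operators is additive in each factor. -/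
theorem sum_tensorOp_of_eq {m : ℕ} {d e : Fin m → ℕ} {ι : Type} (s : Finset ι) (j : Fin m)
    (A : ι → ∀ i, Matrix (Fin (e i)) (Fin (d i)) ℂ) (B : ∀ i, Matrix (Fin (e i)) (Fin (d i)) ℂ)
    (hj : ∑ a ∈ s, A a j = B j) (hi : ∀ a ∈ s, ∀ i, i ≠ j → A a i = B i) :
    ∑ a ∈ s, tensorOp (A a) = tensorOp B := by
  ext x y
  have h : ∀ a ∈ s, tensorOp (A a) x y =
      A a j (x j) (y j) * ∏ i ∈ Finset.univ.erase j, B i (x i) (y i) := by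
    intro a ha
    rw [tensorOp, Matrix.of_apply, ← Finset.mul_prod_erase _ _ (Finset.mem_univ j)]
    congr 1
    exact Finset.prod_congr rfl fun i h => by rw [hi a ha i (Finset.ne_of_mem_erase h)]
  rw [Matrix.sum_apply, Finset.sum_congr rfl h, ← Finset.sum_mul, ← Matrix.sum_apply, hj,
    tensorOp, Matrix.of_apply, ← Finset.mul_prod_erase _ _ (Finset.mem_univ j)]

theorem exists_eq_zero_of_tensorVec_eq_zero {m : ℕ} {d : Fin m → ℕ} {v : ∀ i, Fin (d i) → ℂ}
    (h : tensorVec v = 0) : ∃ i, v i = 0 := by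
  by_contra! hv
  exact tensorVec_ne_zero hv h

theorem tensorVec_eq_zero {m : ℕ} {d : Fin m → ℕ} {v : ∀ i, Fin (d i) → ℂ} {i : Fin m}
    (h : v i = 0) : tensorVec v = 0 := by
  ext x
  exact Finset.prod_eq_zero (Finset.mem_univ i) (by simp [h])

/-! ## LOCC measurements -/

/-- In a round, only the factor of party `j` in `⨂ (A a i)ᴴ * A a i` depends on `a`, the others
being `1` by isometry, so the completeness relation at `j` suffices. -/
theorem IsLOCC.isPOVM {m : ℕ} {K : Type} [DecidableEq K] [Fintype K] {d : Fin m → ℕ}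
    {E : K → Matrix (Index d) (Index d) ℂ} (h : IsLOCC d E) : IsPOVM E := by
  induction h with
  | finish d k₀ =>
    refine ⟨fun k => ?_, by simp⟩
    dsimp only
    split_ifs
    · exact Matrix.PosSemidef.one
    · exact Matrix.PosSemidef.zero
  | round d j r e A F measurement isometry next ih =>
    refine ⟨fun k => Matrix.posSemidef_sum _ fun a _ =>
      ((ih a).1 k).conjTranspose_mul_mul_same _, ?_⟩
    rw [Finset.sum_comm]
    have h1 : ∀ a, ∑ k, (tensorOp (A a))ᴴ * F a k * tensorOp (A a) =
        tensorOp fun i => (A a i)ᴴ * A a i := fun a => by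
      rw [← Matrix.sum_mul, ← Matrix.mul_sum, (ih a).2, Matrix.mul_one, conjTranspose_tensorOp,
        tensorOp_mul]
    rw [Finset.sum_congr rfl fun a _ => h1 a, sum_tensorOp_of_eq _ j _ (fun i => 1) measurement fun a _ i hi => isometry a i hi,
      tensorOp_one]

theorem star_dotProduct_conj_mulVec {ι κ : Type} [Fintype ι] [Fintype κ] (T : Matrix κ ι ℂ)
    (F : Matrix κ κ ℂ) (v : ι → ℂ) :
    star v ⬝ᵥ ((Tᴴ * F * T) *ᵥ v) = star (T *ᵥ v) ⬝ᵥ (F *ᵥ (T *ᵥ v)) := by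
  rw [Matrix.star_mulVec, ← Matrix.dotProduct_mulVec, Matrix.mulVec_mulVec, Matrix.mulVec_mulVec,
    Matrix.mul_assoc]

/-- If an outcome of an LOCC measurement can occur in a product state, then some product operator
does not annihilate this state but annihilates all states in which the outcome cannot occur. -/
theorem IsLOCC.exists_tensorOp {m : ℕ} {K : Type} [DecidableEq K] [Fintype K] {d : Fin m → ℕ}
    {E : K → Matrix (Index d) (Index d) ℂ} (h : IsLOCC d E) (k : K) (v : ∀ i, Fin (d i) → ℂ)
    (hv : star (tensorVec v) ⬝ᵥ (E k *ᵥ tensorVec v) ≠ 0) :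
    ∃ (e : Fin m → ℕ) (B : ∀ i, Matrix (Fin (e i)) (Fin (d i)) ℂ),
      tensorOp B *ᵥ tensorVec v ≠ 0 ∧
        ∀ w, star w ⬝ᵥ (E k *ᵥ w) = 0 → tensorOp B *ᵥ w = 0 := by
  induction h with
  | finish d k₀ =>
    by_cases hk : k = k₀
    · refine ⟨d, fun i => 1, ?_, fun w hw => ?_⟩
      · rw [tensorOp_one, Matrix.one_mulVec]
        intro h0
        simp [h0] at hv
      · simp only [if_pos hk, Matrix.one_mulVec] at hw
        rw [tensorOp_one, Matrix.one_mulVec]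
        exact dotProduct_star_self_eq_zero.mp hw
    · simp [hk] at hv
  | round d j r e A F measurement isometry next ih =>
    simp only [Matrix.sum_mulVec, dotProduct_sum, star_dotProduct_conj_mulVec] at hv
    obtain ⟨a, -, ha⟩ := Finset.exists_ne_zero_of_sum_ne_zero hv
    rw [tensorOp_mulVec_tensorVec] at ha
    obtain ⟨e', B, hB, hB0⟩ := ih a _ ha
    refine ⟨e', fun i => B i * A a i, ?_, fun w hw => ?_⟩
    · rwa [← tensorOp_mul, ← Matrix.mulVec_mulVec, tensorOp_mulVec_tensorVec (A a)]
    · rw [← tensorOp_mul, ← Matrix.mulVec_mulVec]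
      simp only [Matrix.sum_mulVec, dotProduct_sum, star_dotProduct_conj_mulVec] at hw
      -- The branches contribute nonnegative probabilities, so a vanishing total makes branch `a`
      -- vanish as well.
      refine hB0 _ ((Finset.sum_eq_zero_iff_of_nonneg fun b _ => ?_).mp hw a (Finset.mem_univ a))
      exact ((next b).isPOVM.1 k).dotProduct_mulVec_nonneg _

/-- Each party of a set performs a local projective measurement; the outcome `k` is announced if
all of them succeed, otherwise the outcome `k₀`. -/
theorem exists_isLOCC_tensorOp_finset {m : ℕ} {K : Type} [DecidableEq K] {d : Fin m → ℕ}
    (P : ∀ i, Matrix (Fin (d i)) (Fin (d i)) ℂ) (hP : ∀ i, (P i)ᴴ = P i)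
    (hP2 : ∀ i, P i * P i = P i) {k₀ k : K} (hk : k ≠ k₀) (S : Finset (Fin m)) :
    ∃ E : K → Matrix (Index d) (Index d) ℂ, IsLOCC d E ∧
      E k = tensorOp (fun i => if i ∈ S then P i else 1) ∧
        ∀ l, l ≠ k₀ → l ≠ k → E l = 0 := by
  induction S using Finset.induction_on with
  | empty =>
    refine ⟨_, IsLOCC.finish d k, ?_, fun l _ hl => if_neg hl⟩
    simp [tensorOp_one]
  | insert j S hj ih =>
    obtain ⟨E, hE, hEk, hE0⟩ := ih
    -- Party `j` measures `P j` against `1 - P j`: result `0` continues with `E`, result `1`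
    -- announces `k₀`.
    let A : Fin 2 → ∀ i, Matrix (Fin (d i)) (Fin (d i)) ℂ := fun a i =>
      if i = j then (if a = 0 then P i else 1 - P i) else 1
    refine ⟨_, IsLOCC.round d j 2 (fun _ => d) A
      (fun a => if a = 0 then E else fun l => if l = k₀ then 1 else 0) ?_ ?_ ?_, ?_, ?_⟩
    · simp [A, hP, hP2, mul_sub, sub_mul]
    · intro a i hi
      simp [A, hi]
    · intro a
      split_ifs
      · exact hE
      · exact IsLOCC.finish d k₀
    · simp only [Fin.sum_univ_two, if_true, hEk, one_ne_zero, if_false, hk, mul_zero, zero_mul,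
        add_zero, conjTranspose_tensorOp, tensorOp_mul]
      congr 1
      ext1 i
      by_cases hi : i = j
      · subst hi
        simp [A, hj, hP, hP2]
      · simp [A, hi]
    · intro l hl hlk
      simp [hE0 l hl hlk, hl]

/-- LOCC measurements can be mixed uniformly, using local randomness of one party. -/
theorem IsLOCC.uniform_mixture {m : ℕ} {K : Type} [DecidableEq K] {d : Fin m → ℕ} (j : Fin m)
    {n : ℕ} (hn : n ≠ 0) {F : Fin n → K → Matrix (Index d) (Index d) ℂ}
    (hF : ∀ a, IsLOCC d (F a)) :
    IsLOCC d fun k => ∑ a, ((n : ℂ)⁻¹) • F a k := by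
  have hs : ((√(n : ℝ) : ℝ) : ℂ)⁻¹ * ((√(n : ℝ) : ℝ) : ℂ)⁻¹ = (n : ℂ)⁻¹ := by
    rw [← mul_inv, ← Complex.ofReal_mul, Real.mul_self_sqrt n.cast_nonneg, Complex.ofReal_natCast]
  -- Kraus operators enter quadratically, so weight `1/n` needs the scalar `1/√n`.
  let A : Fin n → ∀ i, Matrix (Fin (d i)) (Fin (d i)) ℂ := fun _ i =>
    if i = j then (((√(n : ℝ) : ℝ) : ℂ)⁻¹) • 1 else 1
  have hA : ∀ a, tensorOp (A a) = (((√(n : ℝ) : ℝ) : ℂ)⁻¹) • 1 := by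
    intro a
    rw [← tensorOp_one]
    ext x y
    simp only [tensorOp, Matrix.of_apply, Matrix.smul_apply, smul_eq_mul, A]
    rw [← Finset.mul_prod_erase _ _ (Finset.mem_univ j),
      ← Finset.mul_prod_erase _ (fun i => (1 : Matrix (Fin (d i)) (Fin (d i)) ℂ) (x i) (y i))
        (Finset.mem_univ j), ← mul_assoc]
    congr 1
    · simp
    · exact Finset.prod_congr rfl fun i h => by rw [if_neg (Finset.ne_of_mem_erase h)]
  have h := IsLOCC.round d j n (fun _ => d) A F ?_ ?_ hF
  · convert h using 3 with k a ha
    rw [hA a]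
    simp [Matrix.conjTranspose_smul, smul_smul, hs]
  · simp only [A, if_true, Matrix.conjTranspose_smul, Matrix.conjTranspose_one, smul_mul_smul_comm,
      one_mul, star_inv₀, RCLike.star_def, Complex.conj_ofReal, hs, Finset.sum_const,
      Finset.card_univ, Fintype.card_fin]
    rw [← Nat.cast_smul_eq_nsmul ℂ, smul_smul, mul_inv_cancel₀ (by exact_mod_cast hn), one_smul]
  · intro a i hi
    simp [A, hi]

theorem expectation_productState_eq_zero_iff {m : ℕ} {d : Fin m → ℕ}
    (E : Matrix (Index d) (Index d) ℂ) (φ : ∀ i, PureState (Fin (d i))) :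
    expectation E (productState φ) = 0 ↔
      star (tensorVec fun i => (φ i).rep) ⬝ᵥ (E *ᵥ tensorVec fun i => (φ i).rep) = 0 := by
  obtain ⟨c, hc⟩ := Projectivization.exists_smul_eq_mk_rep ℂ (tensorVec fun i => (φ i).rep)
    (tensorVec_ne_zero fun i => (φ i).rep_nonzero)
  have h0 : star (productState φ).rep ⬝ᵥ (productState φ).rep ≠ 0 := fun h =>
    (productState φ).rep_nonzero (dotProduct_star_self_eq_zero.mp h)
  rw [expectation, div_eq_zero_iff, or_iff_left h0, productState, ← hc, Units.smul_def, star_smul,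
    Matrix.mulVec_smul, smul_dotProduct, dotProduct_smul]
  simp

/-! ## Product states in general position -/

/-- At each party, any at most `d i` of the local states are linearly independent. -/
def InGeneralPosition {m n : ℕ} {d : Fin m → ℕ} (φ : Fin n → ∀ i, PureState (Fin (d i))) : Prop :=
  ∀ (i : Fin m) (r : ℕ) (f : Fin r ↪ Fin n), r ≤ d i →
    LinearIndependent ℂ fun a => (φ (f a) i).rep

theorem InGeneralPosition.linearIndepOn {m n : ℕ} {d : Fin m → ℕ}
    {φ : Fin n → ∀ i, PureState (Fin (d i))} (h : InGeneralPosition φ) (i : Fin m)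
    (S : Finset (Fin n)) (hS : S.card ≤ d i) :
    LinearIndepOn ℂ (fun l => (φ l i).rep) (S : Set (Fin n)) := by
  have h1 := h i S.card (S.equivFin.symm.toEmbedding.trans (Function.Embedding.subtype _)) hS
  exact (linearIndependent_equiv S.equivFin.symm (f := fun l : S => (φ l i).rep)).mp h1

/-- If `B` killed `d i` of the local factors, these would form a basis and `B` would be zero. -/
theorem InGeneralPosition.card_kernel_lt {m n : ℕ} {d : Fin m → ℕ}
    {φ : Fin n → ∀ i, PureState (Fin (d i))} (h : InGeneralPosition φ) (i : Fin m) {e : ℕ}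
    (B : Matrix (Fin e) (Fin (d i)) ℂ) {v : Fin (d i) → ℂ} (hv : B *ᵥ v ≠ 0) (S : Finset (Fin n))
    (hS : ∀ l ∈ S, B *ᵥ (φ l i).rep = 0) : S.card < d i := by
  by_contra! hc
  obtain ⟨T, hTS, hT⟩ := Finset.exists_subset_card_eq hc
  have hli := h.linearIndepOn i T hT.le
  have hspan := hli.linearIndependent.span_eq_top_of_card_eq_finrank' (by simp [hT])
  have hker : LinearMap.ker B.mulVecLin = ⊤ := by
    rw [eq_top_iff, ← hspan, Submodule.span_le]
    rintro _ ⟨l, rfl⟩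
    simpa using hS l (hTS l.2)
  have hv' : v ∈ LinearMap.ker B.mulVecLin := hker ▸ Submodule.mem_top
  exact hv (by simpa using hv')

theorem InGeneralPosition.le_of_distinguishable {m n : ℕ} {d : Fin m → ℕ}
    {φ : Fin n → ∀ i, PureState (Fin (d i))} (h : InGeneralPosition φ)
    (hd : UnambiguouslyLOCCDistinguishable d fun k => productState (φ k)) :
    n ≤ 1 + ∑ i, (d i - 1) := by
  classical
  obtain ⟨E, -, hE, hEφ⟩ := hd
  rcases Nat.eq_zero_or_pos n with rfl | hn
  · exact Nat.zero_le _
  -- The bound needs the conclusive outcome of only one state; any choice works.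
  let k : Fin n := ⟨0, hn⟩
  have hk : expectation (E k.succ) (productState (φ k)) ≠ 0 := fun h0 => (hEφ k k).mp h0 rfl
  rw [Ne, expectation_productState_eq_zero_iff] at hk
  obtain ⟨e, B, hB, hB0⟩ := hE.exists_tensorOp _ _ hk
  have hBk : ∀ i, B i *ᵥ (φ k i).rep ≠ 0 := fun i hi =>
    hB ((tensorOp_mulVec_tensorVec _ _).trans (tensorVec_eq_zero hi))
  let S : Fin m → Finset (Fin n) := fun i => Finset.univ.filter fun l => B i *ᵥ (φ l i).rep = 0
  have hcover : Finset.univ.erase k ⊆ Finset.univ.biUnion S := by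
    intro l hl
    have h1 := (hEφ l k).mpr (Finset.ne_of_mem_erase hl)
    rw [expectation_productState_eq_zero_iff] at h1
    have h2 := hB0 _ h1
    rw [tensorOp_mulVec_tensorVec] at h2
    obtain ⟨i, hi⟩ := exists_eq_zero_of_tensorVec_eq_zero h2
    exact Finset.mem_biUnion.mpr ⟨i, Finset.mem_univ i, by simpa [S] using hi⟩
  have hcard := (Finset.card_le_card hcover).trans Finset.card_biUnion_le
  rw [Finset.card_erase_of_mem (Finset.mem_univ k), Finset.card_univ, Fintype.card_fin] at hcard
  have hsum : ∑ i, (S i).card ≤ ∑ i, (d i - 1) := Finset.sum_le_sum fun i _ =>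
    Nat.le_sub_one_of_lt (h.card_kernel_lt i (B i) (hBk i) (S i) fun l hl => by simpa [S] using hl)
  omega

/-- A rank one projection separating a vector from a subspace. -/
theorem exists_projection_separating {ι : Type} [Fintype ι] {W : Submodule ℂ (ι → ℂ)}
    {v : ι → ℂ} (hv : v ∉ W) :
    ∃ P : Matrix ι ι ℂ, Pᴴ = P ∧ P * P = P ∧ (∀ w ∈ W, P *ᵥ w = 0) ∧
      star v ⬝ᵥ (P *ᵥ v) ≠ 0 := by
  classical
  obtain ⟨f, hfv, hWf⟩ := Submodule.exists_le_ker_of_notMem hv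
  -- The Riesz vector of `f`; the projection is `x xᴴ / ⟨x, x⟩`.
  let x : ι → ℂ := fun i => star (f (Pi.single i 1))
  have hf : ∀ w, star x ⬝ᵥ w = f w := by
    intro w
    conv_rhs => rw [← Finset.univ_sum_single w, map_sum]
    refine Finset.sum_congr rfl fun i _ => ?_
    have h1 : (Pi.single i (w i) : ι → ℂ) = w i • Pi.single i 1 := by
      rw [← Pi.single_smul, smul_eq_mul, mul_one]
    rw [h1, map_smul, smul_eq_mul, mul_comm]
    simp [x]
  have hx : star x ⬝ᵥ x ≠ 0 := by
    intro h0
    have h1 : x = 0 := dotProduct_star_self_eq_zero.mp h0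
    exact hfv (by rw [← hf, h1]; simp)
  have hxr : star (star x ⬝ᵥ x) = star x ⬝ᵥ x := by
    rw [← Matrix.star_dotProduct_star, star_star, dotProduct_comm]
  have hP : ∀ w, ((star x ⬝ᵥ x)⁻¹ • Matrix.vecMulVec x (star x)) *ᵥ w =
      ((star x ⬝ᵥ x)⁻¹ * f w) • x := by
    intro w
    rw [Matrix.smul_mulVec, Matrix.vecMulVec_mulVec, hf w, op_smul_eq_smul, smul_smul]
  refine ⟨(star x ⬝ᵥ x)⁻¹ • Matrix.vecMulVec x (star x), ?_, ?_, ?_, ?_⟩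
  · rw [Matrix.conjTranspose_smul, Matrix.conjTranspose_vecMulVec, star_star, star_inv₀, hxr]
  · rw [smul_mul_smul_comm, Matrix.vecMulVec_mul_vecMulVec, Matrix.vecMulVec_smul, smul_smul,
      mul_assoc, inv_mul_cancel₀ hx, mul_one]
  · intro w hw
    have : f w = 0 := hWf hw
    rw [hP, this, mul_zero, zero_smul]
  · rw [hP, dotProduct_smul, smul_eq_mul]
    refine mul_ne_zero (mul_ne_zero (inv_ne_zero hx) hfv) ?_
    rw [Matrix.star_dotProduct, hf]
    simpa using hfv

theorem InGeneralPosition.exists_projections {m n : ℕ} {d : Fin m → ℕ} [∀ i, NeZero (d i)]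
    {φ : Fin n → ∀ i, PureState (Fin (d i))} (h : InGeneralPosition φ)
    (hn : n ≤ 1 + ∑ i, (d i - 1)) (k : Fin n) :
    ∃ P : ∀ i, Matrix (Fin (d i)) (Fin (d i)) ℂ, (∀ i, (P i)ᴴ = P i) ∧ (∀ i, P i * P i = P i) ∧
      (∀ i, star (φ k i).rep ⬝ᵥ (P i *ᵥ (φ k i).rep) ≠ 0) ∧
        ∀ l, l ≠ k → ∃ i, P i *ᵥ (φ l i).rep = 0 := by
  classical
  -- The embedding assigns each of the `n - 1` other states to a party, with `d i - 1` slots at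
  -- party `i`.
  obtain ⟨g⟩ : Nonempty ({l : Fin n // l ≠ k} ↪ Σ i, Fin (d i - 1)) := by
    refine Function.Embedding.nonempty_of_card_le ?_
    simp only [ne_eq, Fintype.card_subtype_compl, Fintype.card_fin, Fintype.card_subtype_eq,
      Fintype.card_sigma]
    omega
  let S : Fin m → Finset (Fin n) := fun i =>
    Finset.univ.filter fun l => ∃ hl : l ≠ k, (g ⟨l, hl⟩).1 = i
  have hkS : ∀ i, k ∉ S i := by simp [S]
  have hcard : ∀ i, (S i).card ≤ d i - 1 := by
    intro i
    have hmap : ((S i).attach.map ⟨fun l => (⟨l.1, fun hl => hkS i (hl ▸ l.2)⟩ :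
        {l : Fin n // l ≠ k}), fun a b hab => Subtype.ext (congrArg (fun l => (l.1 : Fin n)) hab)⟩).map g ⊆
        (Finset.univ : Finset (Fin (d i - 1))).map (Function.Embedding.sigmaMk i) := by
      intro y hy
      simp only [Finset.mem_map, Finset.mem_attach, true_and] at hy
      obtain ⟨_, ⟨⟨l, hl⟩, rfl⟩, rfl⟩ := hy
      obtain ⟨hlk, hi⟩ := (Finset.mem_filter.mp hl).2
      subst hi
      exact Finset.mem_map.mpr ⟨(g ⟨l, hlk⟩).2, Finset.mem_univ _, rfl⟩
    simpa using Finset.card_le_card hmap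
  have hmem : ∀ i, (φ k i).rep ∉
      Submodule.span ℂ ((fun l => (φ l i).rep) '' (S i : Set (Fin n))) := by
    intro i
    have h1 : LinearIndepOn ℂ (fun l => (φ l i).rep) (insert k (S i : Set (Fin n))) := by
      -- Together with `k` there are at most `d i` indices, just within reach of general position.
      have := h.linearIndepOn i (insert k (S i)) (by
        rw [Finset.card_insert_of_notMem (hkS i)]
        have := hcard i
        have := NeZero.pos (d i)
        omega)
      simpa using this
    exact ((linearIndepOn_insert (by simpa using hkS i)).mp h1).2
  choose P hP hP2 hP0 hPk using fun i => exists_projection_separating (hmem i)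
  refine ⟨P, hP, hP2, hPk, fun l hl => ⟨(g ⟨l, hl⟩).1, ?_⟩⟩
  refine hP0 _ _ (Submodule.subset_span ⟨l, ?_, rfl⟩)
  exact Finset.mem_coe.mpr (Finset.mem_filter.mpr ⟨Finset.mem_univ l, hl, rfl⟩)

theorem InGeneralPosition.distinguishable_of_le {m n : ℕ} {d : Fin m → ℕ} [∀ i, NeZero (d i)]
    {φ : Fin n → ∀ i, PureState (Fin (d i))} (h : InGeneralPosition φ)
    (hn : n ≤ 1 + ∑ i, (d i - 1)) :
    UnambiguouslyLOCCDistinguishable d fun k => productState (φ k) := by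
  suffices h1 : ∃ E : Fin (n + 1) → Matrix (Index d) (Index d) ℂ, IsLOCC d E ∧
      ∀ j k : Fin n, expectation (E k.succ) (productState (φ j)) = 0 ↔ j ≠ k by
    obtain ⟨E, hE, hEφ⟩ := h1
    exact ⟨E, hE.isPOVM, hE, hEφ⟩
  choose P hP hP2 hPk hP0 using h.exists_projections hn
  choose F hF hFk hF0 using fun k : Fin n =>
    exists_isLOCC_tensorOp_finset (P k) (hP k) (hP2 k) (Fin.succ_ne_zero k) Finset.univ
  simp only [Finset.mem_univ, if_true] at hFk
  have hPiff : ∀ j k : Fin n, star (tensorVec fun i => (φ j i).rep) ⬝ᵥ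
      (tensorOp (P k) *ᵥ tensorVec fun i => (φ j i).rep) = 0 ↔ j ≠ k := by
    intro j k
    rw [tensorOp_mulVec_tensorVec, star_tensorVec_dotProduct]
    constructor
    · rintro h0 rfl
      exact Finset.prod_ne_zero_iff.mpr (fun i _ => hPk j i) h0
    · intro hjk
      obtain ⟨i, hi⟩ := hP0 k j hjk
      exact Finset.prod_eq_zero (Finset.mem_univ i) (by rw [hi, dotProduct_zero])
  -- Mixing requires a party to supply the randomness. For `n ≥ 2` the inequality forces `m ≥ 1`;
  -- for `n ≤ 1` no mixing is needed.
  rcases Nat.lt_or_ge 1 n with h1 | h1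
  · obtain ⟨j₀⟩ : Nonempty (Fin m) := by
      by_contra hm
      rw [not_nonempty_iff] at hm
      simp at hn
      omega
    have hn0 : n ≠ 0 := by omega
    refine ⟨_, IsLOCC.uniform_mixture j₀ hn0 hF, fun j k => ?_⟩
    rw [expectation_productState_eq_zero_iff, Finset.sum_eq_single k, hFk, Matrix.smul_mulVec,
      dotProduct_smul, smul_eq_mul, mul_eq_zero, or_iff_right, hPiff]
    · exact inv_ne_zero (by exact_mod_cast hn0)
    · intro a _ ha
      rw [hF0 a _ (Fin.succ_ne_zero k) (by simpa using ha.symm), smul_zero]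
    · simp
  · rcases Nat.eq_zero_or_pos n with rfl | hpos
    · exact ⟨_, IsLOCC.finish d 0, fun j => j.elim0⟩
    · obtain rfl : n = 1 := by omega
      refine ⟨F 0, hF 0, fun j k => ?_⟩
      obtain rfl : k = 0 := Subsingleton.elim _ _
      rw [expectation_productState_eq_zero_iff, hFk, hPiff]

/-! ## Projective space as an open quotient -/

/-- The saturation of an open set is the union of its preimages under scalings by units. Openness of
the quotient map transfers second countability and survives finite products. -/
theorem isOpenQuotientMap_mk (ι : Type) :
    IsOpenQuotientMap
      (fun v : {v : ι → ℂ // v ≠ 0} => (Projectivization.mk ℂ v.1 v.2 : PureState ι)) := by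
  refine ⟨fun ψ => ⟨⟨ψ.rep, ψ.rep_nonzero⟩, ψ.mk_rep⟩, continuous_coinduced_rng, fun U hU => ?_⟩
  refine isOpen_coinduced.mpr ?_
  have h : (fun v : {v : ι → ℂ // v ≠ 0} => (Projectivization.mk ℂ v.1 v.2 : PureState ι)) ⁻¹'
      ((fun v : {v : ι → ℂ // v ≠ 0} => (Projectivization.mk ℂ v.1 v.2 : PureState ι)) '' U) =
      ⋃ c : ℂˣ, (fun v : {v : ι → ℂ // v ≠ 0} =>
        (⟨c • v.1, (smul_ne_zero_iff_ne c).mpr v.2⟩ : {v : ι → ℂ // v ≠ 0})) ⁻¹' U := by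
    ext v
    simp only [Set.mem_preimage, Set.mem_image, Set.mem_iUnion, Projectivization.mk_eq_mk_iff]
    constructor
    · rintro ⟨w, hw, c, hc⟩
      exact ⟨c, by convert hw⟩
    · rintro ⟨c, hc⟩
      exact ⟨_, hc, c, rfl⟩
  rw [h]
  refine isOpen_iUnion fun c => hU.preimage ?_
  exact (continuous_subtype_val.const_smul c).subtype_mk _

instance instSecondCountableTopologyPureState (ι : Type) [Finite ι] :
    SecondCountableTopology (PureState ι) :=
  haveI : SecondCountableTopology {v : ι → ℂ // v ≠ 0} :=
    TopologicalSpace.Subtype.secondCountableTopology {v : ι → ℂ | v ≠ 0}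
  (isOpenQuotientMap_mk ι).isQuotientMap.secondCountableTopology (isOpenQuotientMap_mk ι).isOpenMap

theorem exists_units_smul_rep_mk {ι : Type} (v : ι → ℂ) (hv : v ≠ 0) :
    ∃ c : ℂˣ, (Projectivization.mk ℂ v hv).rep = c • v := by
  obtain ⟨c, hc⟩ := Projectivization.exists_smul_eq_mk_rep ℂ v hv
  exact ⟨c, hc.symm⟩

/-- Independence is open for vectors and invariant under rescaling each one. The measurability
obtained from this is what the Fubini argument needs. -/
theorem isOpen_setOf_linearIndependent_rep (ι : Type) [Finite ι] (r : ℕ) :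
    IsOpen {ψ : Fin r → PureState ι | LinearIndependent ℂ fun a => (ψ a).rep} := by
  rw [← (IsOpenQuotientMap.piMap fun _ : Fin r =>
    isOpenQuotientMap_mk ι).isQuotientMap.isOpen_preimage]
  have hcont : Continuous fun (v : Fin r → {v : ι → ℂ // v ≠ 0}) a => (v a).1 :=
    continuous_pi fun a => continuous_subtype_val.comp (continuous_apply a)
  have : Fintype ι := Fintype.ofFinite ι
  convert (isOpen_setOfPred_linearIndependent (𝕜 := ℂ) (E := ι → ℂ) (ι := Fin r)).preimage hcont
    using 1
  ext v
  choose c hc using fun a => exists_units_smul_rep_mk (v a).1 (v a).2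
  simp only [Set.mem_preimage, Set.mem_ofPred_eq, Pi.map_apply, hc]
  exact LinearIndependent.units_smul_iff (v := fun a => (v a).1) (w := c)

/-! ## Random pure states avoid proper subspaces -/

theorem exists_unitary_mulVec_single {d : ℕ} [NeZero d] {v : Fin d → ℂ} (hv : v ≠ 0) :
    ∃ (V : UGroup d) (c : ℂ), c ≠ 0 ∧
      (V : Matrix (Fin d) (Fin d) ℂ) *ᵥ Pi.single 0 1 = c • v := by
  let u : EuclideanSpace ℂ (Fin d) := WithLp.toLp 2 v
  have hu : u ≠ 0 := fun h => hv (by simpa [u] using h)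
  have hn : (‖u‖ : ℂ) ≠ 0 := by exact_mod_cast norm_ne_zero_iff.mpr hu
  have ho : Orthonormal ℂ
      (({0} : Set (Fin d)).domRestrict fun _ : Fin d => ((‖u‖ : ℂ)⁻¹ • u)) := by
    refine ⟨fun i => ?_, fun i j hij => absurd (Subsingleton.elim i j) hij⟩
    simp only [Set.domRestrict_apply, norm_smul, norm_inv, Complex.norm_real, norm_norm]
    exact inv_mul_cancel₀ (norm_ne_zero_iff.mpr hu)
  obtain ⟨b, hb⟩ := ho.exists_orthonormalBasis_extension_of_card_eq (by simp)
  refine ⟨⟨(EuclideanSpace.basisFun (Fin d) ℂ).toBasis.toMatrix b,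
    (EuclideanSpace.basisFun (Fin d) ℂ).toMatrix_orthonormalBasis_mem_unitary b⟩,
    (‖u‖ : ℂ)⁻¹, inv_ne_zero hn, ?_⟩
  ext i
  simp [Module.Basis.toMatrix_apply, hb 0 rfl, u]

instance instIsMulLeftInvariantHaarUnitary (d : ℕ) : (haarUnitary d).IsMulLeftInvariant := by
  unfold haarUnitary
  infer_instance

/-- The unitaries which map the reference vector to the orthogonal complement of `v`. -/
def orthogonalUnitaries {d : ℕ} [NeZero d] (v : Fin d → ℂ) : Set (UGroup d) :=
  {U | star v ⬝ᵥ ((U : Matrix (Fin d) (Fin d) ℂ) *ᵥ Pi.single 0 1) = 0}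

theorem isClosed_orthogonalUnitaries {d : ℕ} [NeZero d] (v : Fin d → ℂ) :
    IsClosed (orthogonalUnitaries v) := by
  refine isClosed_eq ?_ continuous_const
  exact continuous_const.dotProduct (continuous_subtype_val.matrix_mulVec continuous_const)

/-- Left translation by a unitary taking the reference vector to a multiple of `v` carries one set
to the other. -/
theorem haarUnitary_orthogonalUnitaries_eq {d : ℕ} [NeZero d] {v : Fin d → ℂ} (hv : v ≠ 0) :
    haarUnitary d (orthogonalUnitaries v) =
      haarUnitary d (orthogonalUnitaries (Pi.single 0 1)) := by
  obtain ⟨V, c, hc, hV⟩ := exists_unitary_mulVec_single hv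
  rw [← measure_preimage_mul (haarUnitary d) V (orthogonalUnitaries v)]
  congr 1
  ext U
  have hv' : v = c⁻¹ • ((V : Matrix (Fin d) (Fin d) ℂ) *ᵥ Pi.single 0 1) := by
    rw [hV, smul_smul, inv_mul_cancel₀ hc, one_smul]
  have hVV : (V : Matrix (Fin d) (Fin d) ℂ)ᴴ * V = 1 := Matrix.UnitaryGroup.star_mul_self V
  simp only [orthogonalUnitaries, Set.mem_preimage, Set.mem_ofPred_eq, Submonoid.coe_mul]
  rw [hv', star_smul, smul_dotProduct, Matrix.star_mulVec, ← Matrix.dotProduct_mulVec,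
    Matrix.mulVec_mulVec, ← Matrix.mul_assoc, hVV, Matrix.one_mul, smul_eq_mul, mul_eq_zero,
    or_iff_right]
  simpa using hc

/-- A nonzero vector is orthogonal to fewer than `d` points of the moment curve. -/
theorem card_filter_moment_le {d : ℕ} {x : Fin d → ℂ} (hx : x ≠ 0) (s : Finset ℕ)
    (hs : ∀ t ∈ s, star (fun i : Fin d => (t : ℂ) ^ (i : ℕ)) ⬝ᵥ x = 0) : s.card ≤ d := by
  by_contra! h
  obtain ⟨T, hTs, hT⟩ := Finset.exists_subset_card_eq h.le
  let e : Fin d ≃ T := (T.equivFinOfCardEq hT).symm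
  have hdet : (Matrix.vandermonde fun a => ((e a : ℕ) : ℂ)).det ≠ 0 :=
    Matrix.det_vandermonde_ne_zero_iff.mpr fun a b hab =>
      e.injective (Subtype.ext (by exact_mod_cast hab))
  refine hx (Matrix.eq_zero_of_mulVec_eq_zero hdet ?_)
  ext a
  have h1 := hs (e a) (hTs (e a).2)
  simpa [Matrix.mulVec, dotProduct, Matrix.vandermonde_apply] using h1

/-- The sets belonging to `T` points of the moment curve all have this same measure, and each
unitary lies in at most `d` of them. Integrating gives `T * μ ≤ d` for every `T`, so `μ = 0`. -/
theorem haarUnitary_orthogonalUnitaries {d : ℕ} [NeZero d] {v : Fin d → ℂ} (hv : v ≠ 0) :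
    haarUnitary d (orthogonalUnitaries v) = 0 := by
  classical
  let w : ℕ → Fin d → ℂ := fun t i => (t : ℂ) ^ (i : ℕ)
  have hw : ∀ t, w t ≠ 0 := fun t => Function.ne_iff.mpr ⟨0, by simp [w]⟩
  have hbound : ∀ T : ℕ, (T : ENNReal) * haarUnitary d (orthogonalUnitaries v) ≤ d := by
    intro T
    calc (T : ENNReal) * haarUnitary d (orthogonalUnitaries v)
        = ∑ t ∈ Finset.range T, haarUnitary d (orthogonalUnitaries (w t)) := by
          simp [haarUnitary_orthogonalUnitaries_eq (hw _), haarUnitary_orthogonalUnitaries_eq hv]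
      _ = ∫⁻ U, ∑ t ∈ Finset.range T, (orthogonalUnitaries (w t)).indicator 1 U
            ∂haarUnitary d := by
          rw [lintegral_finsetSum _ fun t _ => measurable_one.indicator
            (isClosed_orthogonalUnitaries (w t)).measurableSet]
          exact Finset.sum_congr rfl fun t _ =>
            (lintegral_indicator_one (isClosed_orthogonalUnitaries (w t)).measurableSet).symm
      _ ≤ ∫⁻ _, d ∂haarUnitary d := by
          refine lintegral_mono fun U => ?_
          simp only [Set.indicator_apply, Pi.one_apply, Finset.sum_boole]
          exact Nat.cast_le.mpr (card_filter_moment_le (unitary_mulVec_ne_zero U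
            (v := Pi.single 0 1) (by simp)) _ fun t ht => (Finset.mem_filter.mp ht).2)
      _ = d := by simp
  by_contra h0
  obtain ⟨T, hT⟩ := ENNReal.exists_nat_mul_gt h0 (ENNReal.natCast_ne_top d)
  exact absurd (hbound T) (not_le.mpr hT)

theorem ae_rep_notMem {d : ℕ} [NeZero d] {W : Submodule ℂ (Fin d → ℂ)} (hW : W ≠ ⊤) :
    ∀ᵐ ψ ∂uniformPureState d, (ψ.rep : Fin d → ℂ) ∉ W := by
  have hmk : ∀ (v : Fin d → ℂ) (hv : v ≠ 0), (Projectivization.mk ℂ v hv).rep ∈ W ↔ v ∈ W := by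
    intro v hv
    obtain ⟨c, hc⟩ := exists_units_smul_rep_mk v hv
    rw [hc, Units.smul_def, W.smul_mem_iff c.ne_zero]
  have hopen : IsOpen {ψ : PureState (Fin d) | (ψ.rep : Fin d → ℂ) ∉ W} := by
    refine isOpen_coinduced.mpr ?_
    simp only [Set.preimage_ofPred_eq, hmk]
    exact W.closed_of_finiteDimensional.isOpen_compl.preimage continuous_subtype_val
  rw [uniformPureState, ae_map_iff (continuous_rotatedState d).measurable.aemeasurable
    hopen.measurableSet]
  obtain ⟨x, hx⟩ : ∃ x, x ∉ W := by
    by_contra! h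
    exact hW (eq_top_iff.mpr fun x _ => h x)
  obtain ⟨P, hPH, -, hPW, hPx⟩ := exists_projection_separating hx
  -- Since `P` is Hermitian and kills `W`, `y` is a nonzero vector orthogonal to `W`.
  let y : Fin d → ℂ := P *ᵥ x
  have hy : y ≠ 0 := fun h => hPx (by rw [show P *ᵥ x = 0 from h, dotProduct_zero])
  have hnull := haarUnitary_orthogonalUnitaries hy
  refine measure_mono_null (fun U hU => ?_) hnull
  have hUW : (U : Matrix (Fin d) (Fin d) ℂ) *ᵥ Pi.single 0 1 ∈ W := by
    simpa [rotatedState, hmk] using hU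
  show star (P *ᵥ x) ⬝ᵥ _ = 0
  rw [Matrix.star_mulVec, hPH, ← Matrix.dotProduct_mulVec, hPW _ hUW, dotProduct_zero]

/-- At most `d` independent random pure states of `ℂ^d` are almost surely linearly independent. -/
theorem ae_linearIndependent_rep {d : ℕ} [NeZero d] {r : ℕ} (hr : r ≤ d) :
    ∀ᵐ ψ ∂Measure.pi fun _ : Fin r => uniformPureState d,
      LinearIndependent ℂ fun a => (ψ a).rep := by
  induction r with
  | zero => exact Filter.Eventually.of_forall fun ψ => linearIndependent_empty_type
  | succ r ih =>
    have hmp := (measurePreserving_piFinSuccAbove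
      (fun _ : Fin (r + 1) => uniformPureState d) 0).symm.comp
        (Measure.measurePreserving_swap
          (μ := Measure.pi fun _ : Fin r => uniformPureState d) (ν := uniformPureState d))
    have hS := (isOpen_setOf_linearIndependent_rep (Fin d) (r + 1)).measurableSet
    rw [← hmp.map_eq, ae_map_iff hmp.measurable.aemeasurable hS]
    -- Fubini: fix `r` independent states; their span is proper because `r < d`, so the new state
    -- almost surely avoids it.
    refine (Measure.ae_prod_iff_ae_ae (hmp.measurable hS)).mpr ?_
    filter_upwards [ih (by omega)] with y hy
    have hW : Submodule.span ℂ (Set.range fun a => (y a).rep) ≠ ⊤ := by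
      intro h
      have h1 := finrank_range_le_card (R := ℂ) fun a => ((y a).rep : Fin d → ℂ)
      rw [Set.finrank, h, finrank_top] at h1
      simp at h1
      omega
    filter_upwards [ae_rep_notMem hW] with x hx
    have h2 := linearIndependent_finCons.mpr ⟨hy, hx⟩
    have hcons : (Fin.cons x.rep fun a => (y a).rep : Fin (r + 1) → Fin d → ℂ) = fun a =>
        ((MeasurableEquiv.piFinSuccAbove (fun _ : Fin (r + 1) => PureState (Fin d)) 0).symm
          (x, y) a).rep := by
      ext1 a
      refine Fin.cases ?_ (fun b => ?_) a <;> simp [MeasurableEquiv.piFinSuccAbove]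
    rw [hcons] at h2
    exact h2

/-- Selecting distinct coordinates preserves product measures. -/
theorem measurePreserving_pi_comp_embedding {ι κ X : Type} [Fintype ι] [Fintype κ]
    [MeasurableSpace X] (μ : Measure X) [IsProbabilityMeasure μ] (f : κ ↪ ι) :
    MeasurePreserving (fun (ψ : ι → X) a => ψ (f a)) (Measure.pi fun _ => μ)
      (Measure.pi fun _ => μ) := by
  classical
  have hf : Measurable fun (ψ : ι → X) a => ψ (f a) :=
    measurable_pi_lambda _ fun a => measurable_pi_apply (f a)
  refine ⟨hf, (Measure.pi_eq fun s hs => ?_).symm⟩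
  rw [Measure.map_apply hf (MeasurableSet.univ_pi hs)]
  -- The intersection is `s a` at `i = f a` and the whole space off the range of `f`, where the
  -- factor has measure `1`.
  have h : (fun (ψ : ι → X) a => ψ (f a)) ⁻¹' Set.univ.pi s =
      Set.univ.pi fun i => ⋂ (a) (_ : f a = i), s a := by
    ext ψ
    simp only [Set.mem_preimage, Set.mem_univ_pi, Set.mem_iInter]
    exact ⟨fun hψ i a hi => hi ▸ hψ a, fun hψ a => hψ _ a rfl⟩
  rw [h, Measure.pi_pi, ← Finset.prod_subset (Finset.subset_univ (Finset.univ.map f)),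
    Finset.prod_map]
  · simp
  · intro i _ hi
    have : ∀ a, f a ≠ i := by simpa using hi
    simp [this]

theorem ae_inGeneralPosition {m : ℕ} (n : ℕ) (d : Fin m → ℕ) [∀ i, NeZero (d i)] :
    ∀ᵐ φ ∂randomProductStates n d, InGeneralPosition φ := by
  simp only [InGeneralPosition]
  refine ae_all_iff.mpr fun i => ae_all_iff.mpr fun r => ae_all_iff.mpr fun f => ?_
  by_cases hr : r ≤ d i
  · have h1 : MeasurePreserving (fun (φ : Fin n → ∀ i, PureState (Fin (d i))) l => φ l i)
        (randomProductStates n d) (Measure.pi fun _ => uniformPureState (d i)) :=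
      measurePreserving_pi _ _ fun _ =>
        measurePreserving_eval (fun i => uniformPureState (d i)) i
    have h2 := (measurePreserving_pi_comp_embedding (uniformPureState (d i)) f).comp h1
    filter_upwards [h2.quasiMeasurePreserving.ae (ae_linearIndependent_rep hr)] with φ hφ _
    exact hφ
  · exact Filter.Eventually.of_forall fun φ h => absurd h hr

end LocalDiscrimination

theorem mainTheorem5 (m n : ℕ) (d : Fin m → ℕ) [∀ i, NeZero (d i)] :
    ∀ᵐ φ ∂(LocalDiscrimination.randomProductStates n d),
      (LocalDiscrimination.UnambiguouslyLOCCDistinguishable d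
          (fun k => LocalDiscrimination.productState (φ k)) ↔
        n ≤ 1 + ∑ i, (d i - 1)) := by
  filter_upwards [LocalDiscrimination.ae_inGeneralPosition n d] with φ hφ
  exact ⟨hφ.le_of_distinguishable, hφ.distinguishable_of_le⟩
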